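/- Let $f(s)=\sum_{n=1}^\infty a_n n^{-s}$ be a Dirichlet series with complex coefficients that converges in at least one point of the complex plane, and for real $\kappa$ write $\mathbb{C}_\kappa=\{s=\sigma+it : \sigma>\kappa\}$. Let $\sigma_{\mathrm{u}}(f)\in[-\infty,\infty]$ be the abscissa of uniform convergence of $f$, that is, the infimum of the real numbers $\kappa$ such that the series converges uniformly in $\mathbb{C}_\kappa$. If there are a real number $\theta$ and complex numbers $\alpha\neq\beta$ such that $f$ has an analytic continuation to $\mathbb{C}_\theta$ that maps $\mathbb{C}_\theta$ to $\mathbb{C}\setminus\{\alpha,\beta\}$, then $\sigma_{\mathrm{u}}(f)\leq\theta$; equivalently, the series converges uniformly in $\mathbb{C}_{\theta+\varepsilon}$ for every $\varepsilon>0$. -/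

import Mathlib

open Filter Topology

namespace DirichletSeries

/-- The open half-plane `{s = σ + it : σ > θ}`. -/
def halfPlane (θ : ℝ) : Set ℂ := {s : ℂ | θ < s.re}

/-- The `N`-th partial sum `∑_{n=1}^N a_n n^{-s}`; the value `a 0` plays no role. -/
noncomputable def partialSum (a : ℕ → ℂ) (N : ℕ) (s : ℂ) : ℂ :=
  ∑ n ∈ Finset.Icc 1 N, a n * (n : ℂ) ^ (-s)

/-- The Dirichlet series with coefficients `a` converges at `s` (not necessarily absolutely). -/
def ConvergesAt (a : ℕ → ℂ) (s : ℂ) : Prop :=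
  ∃ l : ℂ, Tendsto (fun N : ℕ => partialSum a N s) atTop (𝓝 l)

/-- The Dirichlet series with coefficients `a` converges in at least one point. -/
def SomewhereConvergent (a : ℕ → ℂ) : Prop := ∃ s : ℂ, ConvergesAt a s

/-- The abscissa of convergence, with values in `[-∞, ∞]`. -/
noncomputable def abscissaOfConv (a : ℕ → ℂ) : EReal :=
  sInf {x : EReal | ∃ s : ℂ, ConvergesAt a s ∧ x = ((s.re : ℝ) : EReal)}

/-- The Dirichlet series with coefficients `a` converges uniformly on the set `S`. -/
def ConvergesUniformlyOn (a : ℕ → ℂ) (S : Set ℂ) : Prop :=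
  ∃ g : ℂ → ℂ, TendstoUniformlyOn (partialSum a) g atTop S

/-- The abscissa of uniform convergence, with values in `[-∞, ∞]`: the infimum of the real `κ` such
that the series converges uniformly in the half-plane `σ > κ`. -/
noncomputable def abscissaOfUnifConv (a : ℕ → ℂ) : EReal :=
  sInf {x : EReal | ∃ κ : ℝ, ConvergesUniformlyOn a (halfPlane κ) ∧ x = (κ : EReal)}

/-- `F` is an analytic continuation to the half-plane `σ > θ` of the sum of the Dirichlet series
with coefficients `a`: it is analytic there, and it equals the sum of the series at every point of
that half-plane that lies in the open half-plane of convergence. -/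
def IsAnalyticContinuation (a : ℕ → ℂ) (θ : ℝ) (F : ℂ → ℂ) : Prop :=
  AnalyticOnNhd ℂ F (halfPlane θ) ∧
    ∀ s ∈ halfPlane θ, abscissaOfConv a < ((s.re : ℝ) : EReal) →
      Tendsto (fun N : ℕ => partialSum a N s) atTop (𝓝 (F s))

end DirichletSeries

/-! Omitting two values makes the continuation `F` bounded on smaller half-planes, and boundedness
forces uniform convergence of the series.

Boundedness comes from Schottky's theorem. Far to the right the series converges absolutely, so `F`
is bounded on a line `σ = c`. Discs centred on that line and tangent to `σ = θ` all have the same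
radius, so Schottky's constant does not depend on the height of the centre, and slightly smaller
discs cover the strip up to `σ = θ + ε`. Schottky's theorem in turn rests on Bloch's: a function
omitting `0` and `1` is an iterated cosine of some `h` whose image contains no disc of radius `2`,
which bounds `h'`.

Uniform convergence (Bohr's theorem) comes from a smoothed Perron formula: the `N`-th remainder at
`s` is `1 / 2π` times the integral of `F (s + w)` against a kernel on `Re w = -δ`. Mellin inversion
of `min 1 x` gives the formula where the series converges absolutely, and the identity theorem
carries it to the left. The kernel has `L¹` norm `O(N ^ (-δ/2))`, so a bounded `F` has remainders
tending to zero uniformly. -/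

namespace DirichletSeries

open Complex Metric Set MeasureTheory

/-! ### Schottky's theorem by way of Bloch's theorem -/

/-- A nonvanishing holomorphic function on a disc has a holomorphic logarithm with any prescribed
logarithm of the central value. -/
lemma exists_exp_eq_on_ball {f : ℂ → ℂ} {c : ℂ} {R : ℝ} (hR : 0 < R)
    (hf : DifferentiableOn ℂ f (ball c R)) (h0 : ∀ z ∈ ball c R, f z ≠ 0) {w : ℂ}
    (hw : exp w = f c) :
    ∃ L : ℂ → ℂ, DifferentiableOn ℂ L (ball c R) ∧ L c = w ∧ ∀ z ∈ ball c R, exp (L z) = f z := by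
  have hd : DifferentiableOn ℂ (fun z => deriv f z / f z) (ball c R) :=
    (hf.deriv isOpen_ball).div hf h0
  obtain ⟨L, hL, hLd⟩ := (hd.isExactOn_ball).with_val_at c w
  refine ⟨L, fun z hz => (hLd z hz).differentiableAt.differentiableWithinAt, hL, ?_⟩
  have hc : c ∈ ball c R := mem_ball_self hR
  have key : ∀ z ∈ ball c R, HasDerivAt (fun z => f z * exp (-L z)) 0 z := by
    intro z hz
    have h1 := ((hf.differentiableAt (isOpen_ball.mem_nhds hz)).hasDerivAt).mul
      ((hLd z hz).neg.cexp)
    refine h1.congr_deriv ?_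
    have := h0 z hz
    field_simp
    ring
  intro z hz
  have := isOpen_ball.is_const_of_deriv_eq_zero (convex_ball c R).isPreconnected
    (fun z hz => (key z hz).differentiableAt.differentiableWithinAt)
    (fun z hz => (key z hz).deriv) hz hc
  simp only [hL, exp_neg, hw, mul_inv_cancel₀ (h0 c hc)] at this
  have h2 := exp_ne_zero (L z)
  field_simp at this
  exact this.symm

/-- A holomorphic function on a disc that omits `1` and `-1` is `cos (π h)` with `h` holomorphic
and `h c` controlled by the central value. -/
lemma exists_cos_pi_eq_on_ball {f : ℂ → ℂ} {c : ℂ} {R : ℝ} (hR : 0 < R)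
    (hf : DifferentiableOn ℂ f (ball c R)) (h1 : ∀ z ∈ ball c R, f z ≠ 1)
    (h2 : ∀ z ∈ ball c R, f z ≠ -1) :
    ∃ h : ℂ → ℂ, DifferentiableOn ℂ h (ball c R) ∧ ‖h c‖ ≤ 2 * ‖f c‖ + 2 ∧
      ∀ z ∈ ball c R, cos (Real.pi * h z) = f z := by
  have hc : c ∈ ball c R := mem_ball_self hR
  have hn : ∀ z ∈ ball c R, f z ^ 2 - 1 ≠ 0 := by
    intro z hz h
    have : (f z - 1) * (f z + 1) = 0 := by linear_combination h
    rcases mul_eq_zero.1 this with h | h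
    · exact h1 z hz (sub_eq_zero.1 h)
    · exact h2 z hz (eq_neg_of_add_eq_zero_left h)
  obtain ⟨L, hLd, -, hL⟩ := exists_exp_eq_on_ball hR ((hf.pow 2).sub_const 1) hn
    (exp_log (hn c hc))
  -- `q` is a square root of `f ^ 2 - 1`, so `f + q` and `f - q` are mutually inverse. With `exp G =
  -- f + q`, the cosine of `G / I` is `f`.
  set q : ℂ → ℂ := fun z => exp (L z / 2) with hq
  have hqd : DifferentiableOn ℂ q (ball c R) := (hLd.div_const 2).cexp
  have hq2 : ∀ z ∈ ball c R, q z ^ 2 = f z ^ 2 - 1 := by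
    intro z hz
    change _ = (f ^ 2) z - 1
    rw [← hL z hz, hq, ← exp_nat_mul]
    congr 1
    push_cast; ring
  have hprod : ∀ z ∈ ball c R, (f z + q z) * (f z - q z) = 1 := by
    intro z hz
    linear_combination -(hq2 z hz)
  have hp0 : ∀ z ∈ ball c R, f z + q z ≠ 0 := by
    intro z hz h
    have := hprod z hz
    simp [h] at this
  obtain ⟨G, hGd, hGc, hG⟩ := exists_exp_eq_on_ball hR (hf.add hqd) hp0 (exp_log (hp0 c hc))
  refine ⟨fun z => G z / (Real.pi * I), hGd.div_const _, ?_, ?_⟩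
  · have hqn : ‖q c‖ ≤ ‖f c‖ + 1 := by
      have h3 : ‖q c‖ ^ 2 ≤ ‖f c‖ ^ 2 + 1 := by
        rw [← norm_pow, hq2 c hc]
        exact (norm_sub_le _ _).trans (by simp)
      nlinarith [norm_nonneg (f c), norm_nonneg (q c)]
    have ha : ‖f c + q c‖ ≤ 2 * ‖f c‖ + 1 := (norm_add_le _ _).trans (by linarith)
    have hb : ‖f c - q c‖ ≤ 2 * ‖f c‖ + 1 := (norm_sub_le _ _).trans (by linarith)
    have hpr : ‖f c + q c‖ * ‖f c - q c‖ = 1 := by rw [← norm_mul, hprod c hc, norm_one]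
    have hpos : 0 < ‖f c + q c‖ := norm_pos_iff.2 (hp0 c hc)
    have hpos' : 0 < ‖f c - q c‖ := by
      by_contra h
      have := le_antisymm (not_lt.1 h) (norm_nonneg _)
      rw [this] at hpr; simp at hpr
    -- The logarithm is bounded below as well as above because the inverse `f c - q c` obeys the
    -- same upper bound.
    have hl1 : Real.log ‖f c + q c‖ ≤ 2 * ‖f c‖ :=
      (Real.log_le_sub_one_of_pos hpos).trans (by linarith)
    have hl2 : -(2 * ‖f c‖) ≤ Real.log ‖f c + q c‖ := by
      have : Real.log ‖f c + q c‖ + Real.log ‖f c - q c‖ = 0 := by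
        rw [← Real.log_mul hpos.ne' hpos'.ne', hpr, Real.log_one]
      have := Real.log_le_sub_one_of_pos hpos'
      linarith
    have hlog : ‖Complex.log (f c + q c)‖ ≤ 2 * ‖f c‖ + Real.pi := by
      refine (norm_le_abs_re_add_abs_im _).trans ?_
      rw [log_re, log_im]
      exact add_le_add (abs_le.2 ⟨hl2, hl1⟩) (abs_arg_le_pi _)
    simp only
    rw [hGc, norm_div, norm_mul, norm_I, mul_one, norm_real, Real.norm_eq_abs,
      abs_of_pos Real.pi_pos, div_le_iff₀ Real.pi_pos]
    have := Real.pi_gt_three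
    simp only [Pi.add_apply]
    nlinarith [norm_nonneg (f c)]
  · intro z hz
    have hpi : (Real.pi : ℂ) ≠ 0 := by exact_mod_cast Real.pi_ne_zero
    have e1 : (Real.pi : ℂ) * (G z / (Real.pi * I)) * I = G z := by
      field_simp
    have e2 : exp (-G z) = f z - q z := by
      rw [exp_neg, hG z hz]
      exact inv_eq_of_mul_eq_one_right (hprod z hz)
    rw [Complex.cos, e1, neg_mul, e1, e2, hG z hz]
    simp only [Pi.add_apply]
    ring

/-- Every disc of radius `2` contains a point where `cos (π ·)` takes an integer value. -/
lemma exists_cos_pi_eq_int (w : ℂ) : ∃ z ∈ ball w 2, ∃ n : ℤ, cos (Real.pi * z) = n := by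
  have hcosh : ∀ v : ℝ, 0 ≤ v → ∃ y, |y - v| ≤ 1 ∧ ∃ n : ℤ, Real.cosh (Real.pi * y) = n := by
    intro v hv
    have hpi := Real.pi_gt_three
    -- Growth by at least `1` over a unit interval makes `cosh (π ·)` pass through an integer there.
    have hgrow : Real.cosh (Real.pi * v) + 1 ≤ Real.cosh (Real.pi * (v + 1)) := by
      have e : Real.cosh (Real.pi * (v + 1)) = Real.cosh (Real.pi * v) * Real.cosh Real.pi +
          Real.sinh (Real.pi * v) * Real.sinh Real.pi := by
        rw [← Real.cosh_add]; ring_nf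
      have h1 : 0 ≤ Real.sinh (Real.pi * v) := Real.sinh_nonneg_iff.2 (by positivity)
      have h2 : 3 ≤ Real.sinh Real.pi := hpi.le.trans (Real.self_le_sinh_iff.2 (by positivity))
      have h3 : 2 ≤ Real.cosh Real.pi := by linarith [Real.sinh_lt_cosh Real.pi]
      have h4 := Real.one_le_cosh (Real.pi * v)
      rw [e]; nlinarith [mul_nonneg h1 (by linarith : 0 ≤ Real.sinh Real.pi)]
    have hivt := intermediate_value_Icc (show v ≤ v + 1 by linarith)
      (f := fun y => Real.cosh (Real.pi * y)) (by fun_prop)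
    obtain ⟨y, hy, hy'⟩ := hivt ⟨Int.le_ceil (Real.cosh (Real.pi * v)),
      (Int.ceil_lt_add_one _).le.trans hgrow⟩
    exact ⟨y, abs_le.2 ⟨by linarith [hy.1], by linarith [hy.2]⟩, _, hy'⟩
  obtain ⟨y, hy, n, hn⟩ : ∃ y, |y - w.im| ≤ 1 ∧ ∃ n : ℤ, Real.cosh (Real.pi * y) = n := by
    rcases le_total 0 w.im with h | h
    · exact hcosh _ h
    · obtain ⟨y, hy, n, hn⟩ := hcosh (-w.im) (by linarith)
      refine ⟨-y, ?_, n, ?_⟩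
      · rw [abs_sub_comm]; convert hy using 2; ring
      · rw [mul_neg, Real.cosh_neg, hn]
  -- At `k + iy` with `k` an integer, the cosine is `(-1) ^ k * cosh (π y)`. The distance to `w` is
  -- at most `1/2 + 1`.
  refine ⟨(round w.re : ℝ) + y * I, ?_, (round w.re).negOnePow * n, ?_⟩
  · rw [mem_ball, dist_eq_norm]
    refine (norm_le_abs_re_add_abs_im _).trans_lt ?_
    have := abs_sub_round w.re
    rw [abs_sub_comm] at this
    simp only [sub_re, add_re, ofReal_re, mul_re, I_re, ofReal_im, I_im, sub_im, add_im, mul_im]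
    ring_nf at this hy ⊢
    linarith
  · have e : (Real.pi : ℂ) * ((round w.re : ℝ) + y * I) =
        (Real.pi * y : ℝ) * I + (round w.re) * Real.pi := by
      push_cast; ring
    rw [e, Complex.cos_antiperiodic.add_int_mul_eq, Complex.cos_mul_I, ← ofReal_cosh, hn]
    push_cast
    rfl

/-- Quantitative open mapping: on a disc where `‖h'‖ ≤ 2 ‖h' z₀‖`, the image contains a disc of
radius proportional to `t ‖h' z₀‖`. -/
lemma ball_subset_image_of_deriv_le {h : ℂ → ℂ} {z₀ : ℂ} {t : ℝ} (ht : 0 < t)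
    (hd : DifferentiableOn ℂ h (ball z₀ t)) (h0 : deriv h z₀ ≠ 0)
    (hb : ∀ z ∈ ball z₀ t, ‖deriv h z‖ ≤ 2 * ‖deriv h z₀‖) :
    ball (h z₀) (t * ‖deriv h z₀‖ / 24) ⊆ h '' ball z₀ t := by
  have hc : z₀ ∈ ball z₀ t := mem_ball_self ht
  set m := ‖deriv h z₀‖ with hm
  have hm0 : 0 < m := norm_pos_iff.2 h0
  have hd' : DifferentiableOn ℂ (deriv h) (ball z₀ t) := hd.deriv isOpen_ball
  -- Schwarz's lemma for `deriv h`, which stays within `3 * m` of its central value. On radius `t /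
  -- 6` the deviation is then at most `m / 2`, so the linear part of `h` dominates.
  have hlip : ∀ z ∈ ball z₀ t, ‖deriv h z - deriv h z₀‖ ≤ 3 * m / t * ‖z - z₀‖ := by
    intro z hz
    have := dist_le_div_mul_dist_of_mapsTo_ball (R₂ := 3 * m) hd' (fun x hx => by
      rw [mem_closedBall, dist_eq_norm]
      exact (norm_sub_le _ _).trans (by linarith [hb x hx])) hz
    simpa only [dist_eq_norm] using this
  have hsub : closedBall z₀ (t / 6) ⊆ ball z₀ t := closedBall_subset_ball (by linarith)
  have hest : ∀ z ∈ sphere z₀ (t / 6), t * m / 12 ≤ ‖h z - h z₀‖ := by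
    intro z hz
    have hk := (convex_closedBall z₀ (t / 6)).norm_image_sub_le_of_norm_hasDerivWithin_le
      (f := fun z => h z - deriv h z₀ * z) (f' := fun z => deriv h z - deriv h z₀)
      (C := m / 2) (x := z₀) (y := z) (fun x hx => by
        have h1 := (hd.differentiableAt (isOpen_ball.mem_nhds (hsub hx))).hasDerivAt
        simpa [Pi.sub_def] using (h1.sub ((hasDerivAt_id x).const_mul (deriv h z₀))).hasDerivWithinAt)
      (fun x hx => by
        refine (hlip x (hsub hx)).trans ?_
        rw [mem_closedBall, dist_eq_norm] at hx
        calc 3 * m / t * ‖x - z₀‖ ≤ 3 * m / t * (t / 6) := by gcongr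
          _ = m / 2 := by field_simp; norm_num)
      (mem_closedBall_self (by positivity)) (sphere_subset_closedBall hz)
    have hz' : ‖z - z₀‖ = t / 6 := by rwa [mem_sphere, dist_eq_norm] at hz
    have htri : ‖deriv h z₀ * (z - z₀)‖ ≤ ‖h z - h z₀‖ +
        ‖h z - deriv h z₀ * z - (h z₀ - deriv h z₀ * z₀)‖ := by
      have : deriv h z₀ * (z - z₀) =
        (h z - h z₀) - (h z - deriv h z₀ * z - (h z₀ - deriv h z₀ * z₀)) := by ring
      rw [this]; exact norm_sub_le _ _
    rw [norm_mul, hz', ← hm] at htri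
    rw [hz'] at hk
    linarith
  have hdc : DiffContOnCl ℂ h (ball z₀ (t / 6)) :=
    (hd.mono ((closure_ball_subset_closedBall).trans hsub)).diffContOnCl
  have hne : ∃ᶠ z in 𝓝 z₀, h z ≠ h z₀ := by
    intro hcon
    apply h0
    have : h =ᶠ[𝓝 z₀] fun _ => h z₀ := hcon.mono fun z hz => not_not.1 hz
    rw [this.deriv_eq, deriv_const]
  have := hdc.ball_subset_image_closedBall (by positivity) hest hne
  refine (this.trans (image_mono hsub)).trans' (ball_subset_ball (by linarith))

/-- **Bloch's theorem** (without an explicit optimal constant): if a holomorphic function on a disc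
of radius `R` has no disc of radius `2` in its image, its central derivative is at most `96 / R`. -/
lemma norm_deriv_le_of_forall_not_ball_subset {h : ℂ → ℂ} {c : ℂ} {R : ℝ} (hR : 0 < R)
    (hd : DifferentiableOn ℂ h (ball c R)) (hn : ∀ w, ¬ ball w 2 ⊆ h '' ball c R) :
    ‖deriv h c‖ ≤ 96 / R := by
  have hstep : ∀ r, 0 < r → r < R → r * ‖deriv h c‖ ≤ 96 := by
    intro r hr hrR
    have hsub : closedBall c r ⊆ ball c R := closedBall_subset_ball hrR
    have hcont : ContinuousOn (fun z => (r - dist z c) * ‖deriv h z‖) (closedBall c r) :=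
      (by fun_prop : Continuous fun z => r - dist z c).continuousOn.mul
        -- Landau's device: at a maximum `z₀` of the weighted derivative, halving the distance to
        -- the boundary at most halves the weight, so `‖h'‖ ≤ 2 ‖h' z₀‖` on the disc of radius `t`.
        -- If the maximum exceeded `96`, the image would contain a disc of radius `96 / 48 = 2`.
        (((hd.deriv isOpen_ball).continuousOn.mono hsub).norm)
    obtain ⟨z₀, hz₀, hmax⟩ := (isCompact_closedBall c r).exists_isMaxOn
      ⟨c, mem_closedBall_self hr.le⟩ hcont
    have hmc : r * ‖deriv h c‖ ≤ (r - dist z₀ c) * ‖deriv h z₀‖ := by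
      simpa using hmax (mem_closedBall_self hr.le)
    by_contra! hcon
    have hz₀' : dist z₀ c ≤ r := hz₀
    have hpos : 0 < (r - dist z₀ c) * ‖deriv h z₀‖ := by linarith
    have hd0 : 0 < r - dist z₀ c := by
      rcases (sub_nonneg.2 hz₀').lt_or_eq with h | h
      · exact h
      · rw [← h] at hpos; simp at hpos
    have hm0 : 0 < ‖deriv h z₀‖ := pos_of_mul_pos_right hpos hd0.le
    set t := (r - dist z₀ c) / 2 with ht
    have ht0 : 0 < t := by positivity
    have hball : ∀ z ∈ ball z₀ t, dist z c ≤ r - t := by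
      intro z hz
      have := dist_triangle z z₀ c
      rw [mem_ball] at hz
      linarith
    have hbs : ball z₀ t ⊆ ball c R := fun z hz => by
      rw [mem_ball]; linarith [hball z hz]
    have := ball_subset_image_of_deriv_le ht0 (hd.mono hbs) (norm_pos_iff.1 hm0) (by
      intro z hz
      have h1 := hball z hz
      have h2 : (r - dist z c) * ‖deriv h z‖ ≤ (r - dist z₀ c) * ‖deriv h z₀‖ :=
        hmax (show z ∈ closedBall c r from mem_closedBall.2 (by linarith))
      have h3 : t * ‖deriv h z‖ ≤ (r - dist z c) * ‖deriv h z‖ := by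
        gcongr; linarith
      have h4 : t * ‖deriv h z‖ ≤ t * (2 * ‖deriv h z₀‖) := by
        calc _ ≤ _ := h3.trans h2
          _ = _ := by rw [ht]; ring
      exact le_of_mul_le_mul_left h4 ht0)
    refine hn (h z₀) ((ball_subset_ball ?_).trans (this.trans (image_mono hbs)))
    rw [ht]; linarith
  rw [le_div_iff₀ hR, mul_comm]
  refine le_of_tendsto (f := fun r => r * ‖deriv h c‖) (x := 𝓝[<] R)
    (((continuous_id.mul continuous_const).tendsto R).mono_left nhdsWithin_le_nhds) ?_
  filter_upwards [Ioo_mem_nhdsLT hR] with r hr using hstep r hr.1 hr.2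

/-- **Schottky's theorem**: a holomorphic function on a disc of radius `R` omitting `0` and `1` is
bounded on smaller concentric discs in terms of a bound for the central value. -/
theorem exists_norm_le_of_forall_ne_zero_ne_one {r R : ℝ} (hr : 0 < r) (hrR : r < R) (M : ℝ) :
    ∃ C : ℝ, ∀ (f : ℂ → ℂ) (c : ℂ), DifferentiableOn ℂ f (ball c R) →
      (∀ z ∈ ball c R, f z ≠ 0) → (∀ z ∈ ball c R, f z ≠ 1) → ‖f c‖ ≤ M →
      ∀ z ∈ closedBall c r, ‖f z‖ ≤ C := by
  -- `B` bounds `h`: two rounds of the central estimate starting from `‖2 * f c - 1‖ ≤ 2 * M + 1`,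
  -- plus Bloch's bound on `h'` times the radius. The nested exponentials undo the two cosines.
  set B := 2 * (2 * (2 * M + 1) + 2) + 2 + 96 / (R - r) * r with hB
  refine ⟨1 + Real.exp (Real.pi * Real.exp (Real.pi * B)), ?_⟩
  intro f c hf h0 h1 hM z hz
  have hR : 0 < R := hr.trans hrR
  have hcosn : ∀ w : ℂ, ‖cos w‖ ≤ Real.exp ‖w‖ := by
    intro w
    rw [Complex.cos, norm_div]
    have e1 := norm_exp_le_exp_norm (w * I)
    have e2 := norm_exp_le_exp_norm (-w * I)
    simp only [norm_mul, norm_neg, norm_I, mul_one] at e1 e2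
    have := norm_add_le (exp (w * I)) (exp (-w * I))
    rw [Complex.norm_ofNat]
    linarith
  have hpi := Real.pi_pos
  obtain ⟨G, hGd, hGc, hG⟩ := exists_cos_pi_eq_on_ball (f := fun z => 2 * f z - 1) hR
    ((hf.const_mul 2).sub_const 1)
    (fun z hz h => h1 z hz (by linear_combination h / 2))
    (fun z hz h => h0 z hz (by linear_combination h / 2))
  have hGint : ∀ z ∈ ball c R, ∀ n : ℤ, G z ≠ n := by
    intro z hz n hn
    have h2 := hG z hz
    have h3 := Complex.sin_sq_add_cos_sq (Real.pi * (n : ℂ))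
    rw [mul_comm, Complex.sin_int_mul_pi, mul_comm, ← hn, h2] at h3
    have h4 : f z * (f z - 1) = 0 := by linear_combination h3 / 4
    rcases mul_eq_zero.1 h4 with h | h
    · exact h0 z hz h
    · exact h1 z hz (sub_eq_zero.1 h)
  obtain ⟨h, hhd, hhc, hh⟩ := exists_cos_pi_eq_on_ball hR hGd
    (fun z hz => by simpa using hGint z hz 1) (fun z hz => by simpa using hGint z hz (-1))
  -- `h` avoids every point where `cos (π ·)` is an integer, since `G` omits the integers.
  have hnb : ∀ w, ¬ ball w 2 ⊆ h '' ball c R := by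
    intro w hw
    obtain ⟨u, hu, n, hn⟩ := exists_cos_pi_eq_int w
    obtain ⟨v, hv, rfl⟩ := hw hu
    exact hGint v hv n ((hh v hv).symm.trans hn)
  have hsub : closedBall c r ⊆ ball c R := closedBall_subset_ball hrR
  have hder : ∀ v ∈ closedBall c r, ‖deriv h v‖ ≤ 96 / (R - r) := by
    intro v hv
    have hbs : ball v (R - r) ⊆ ball c R := ball_subset_ball' (by
      rw [mem_closedBall] at hv; linarith)
    exact norm_deriv_le_of_forall_not_ball_subset (by linarith) (hhd.mono hbs)
      fun w hw => hnb w (hw.trans (image_mono hbs))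
  have hdist := (convex_closedBall c r).norm_image_sub_le_of_norm_deriv_le (𝕜 := ℂ)
    (fun v hv => hhd.differentiableAt (isOpen_ball.mem_nhds (hsub hv))) hder
    (mem_closedBall_self hr.le) hz
  have hzr : ‖z - c‖ ≤ r := by rwa [mem_closedBall, dist_eq_norm] at hz
  have hhz : ‖h z‖ ≤ B := by
    have e1 : ‖h z‖ ≤ ‖h c‖ + ‖h z - h c‖ := by
      simpa using norm_add_le (h c) (h z - h c)
    have e2 : 96 / (R - r) * ‖z - c‖ ≤ 96 / (R - r) * r := by
      have : 0 < R - r := by linarith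
      gcongr
    have e3 : ‖2 * f c - 1‖ ≤ 2 * M + 1 := (norm_sub_le _ _).trans (by
      simp only [norm_mul, Complex.norm_ofNat, norm_one]; linarith)
    rw [hB]; linarith
  have hGz : ‖G z‖ ≤ Real.exp (Real.pi * B) := by
    rw [← hh z (hsub hz)]
    refine (hcosn _).trans (Real.exp_le_exp.2 ?_)
    rw [norm_mul, norm_real, Real.norm_eq_abs, abs_of_pos hpi]
    gcongr
  have h2 : ‖2 * f z - 1‖ ≤ Real.exp (Real.pi * Real.exp (Real.pi * B)) := by
    rw [← hG z (hsub hz)]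
    refine (hcosn _).trans (Real.exp_le_exp.2 ?_)
    rw [norm_mul, norm_real, Real.norm_eq_abs, abs_of_pos hpi]
    gcongr
  have h3 : ‖(2 : ℂ) * f z‖ ≤ ‖2 * f z - 1‖ + ‖(1 : ℂ)‖ := by
    simpa using norm_add_le (2 * f z - 1) 1
  rw [norm_mul, Complex.norm_ofNat, norm_one] at h3
  linarith [norm_nonneg (f z)]

/-! ### Mellin inversion on the line `σ = -δ` -/

/-- The point `-δ + iy` of the vertical line `σ = -δ`. -/
noncomputable def vert (δ y : ℝ) : ℂ := ((-δ : ℝ) : ℂ) + y * I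

@[simp] lemma vert_re (δ y : ℝ) : (vert δ y).re = -δ := by simp [vert]

@[simp] lemma vert_im (δ y : ℝ) : (vert δ y).im = y := by simp [vert]

@[fun_prop] lemma continuous_vert (δ : ℝ) : Continuous (vert δ) := by
  unfold vert; fun_prop

lemma vert_ne_zero {δ : ℝ} (hδ : 0 < δ) (y : ℝ) : vert δ y ≠ 0 := by
  intro h
  have := congrArg re h
  simp at this; linarith

lemma vert_add_one_ne_zero {δ : ℝ} (hδ : δ < 1) (y : ℝ) : vert δ y + 1 ≠ 0 := by
  intro h
  have := congrArg re h
  simp at this; linarith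

lemma mul_sqrt_le_norm_vert {δ : ℝ} (hδ : 0 < δ) (hδ' : δ ≤ 1 / 2) (y : ℝ) :
    δ * √(1 + ‖y‖ ^ 2) ≤ ‖vert δ y‖ := by
  rw [Complex.norm_eq_sqrt_sq_add_sq]
  refine Real.le_sqrt_of_sq_le ?_
  rw [mul_pow, Real.sq_sqrt (by positivity), Real.norm_eq_abs, sq_abs, vert_re, vert_im]
  nlinarith [sq_nonneg y, mul_nonneg (sq_nonneg y) (by nlinarith : 0 ≤ 1 - δ ^ 2)]

lemma mul_sqrt_le_norm_vert_add_one {δ : ℝ} (hδ : 0 < δ) (hδ' : δ ≤ 1 / 2) (y : ℝ) :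
    δ * √(1 + ‖y‖ ^ 2) ≤ ‖vert δ y + 1‖ := by
  rw [Complex.norm_eq_sqrt_sq_add_sq]
  refine Real.le_sqrt_of_sq_le ?_
  rw [mul_pow, Real.sq_sqrt (by positivity), Real.norm_eq_abs, sq_abs]
  simp only [add_re, vert_re, one_re, add_im, vert_im, one_im, add_zero]
  nlinarith [sq_nonneg y, mul_nonneg (sq_nonneg y) (by nlinarith : 0 ≤ 1 - δ ^ 2)]

/-- The function `min 1 u` on `u > 0`, written so that its Mellin transform is readily computed. -/
noncomputable def truncId (u : ℝ) : ℂ :=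
  indicator (Ioc 0 1) (fun t : ℝ => (t : ℂ) ^ (1 : ℂ)) u + indicator (Ioi 1) (fun _ => 1) u

lemma truncId_eq {u : ℝ} (hu : 0 < u) : truncId u = (min 1 u : ℝ) := by
  unfold truncId
  rcases le_or_gt u 1 with h | h
  · rw [indicator_of_mem (show u ∈ Ioc (0 : ℝ) 1 from ⟨hu, h⟩),
      indicator_of_notMem (by simpa using h), min_eq_right h]
    simp
  · rw [indicator_of_notMem (by simp [h]), indicator_of_mem (by simpa using h), min_eq_left h.le]
    simp

lemma continuousAt_truncId {u : ℝ} (hu : 0 < u) : ContinuousAt truncId u := by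
  have : ContinuousAt (fun u : ℝ => ((min 1 u : ℝ) : ℂ)) u := by fun_prop
  refine this.congr ?_
  filter_upwards [Ioi_mem_nhds hu] with x hx using (truncId_eq hx).symm

/-- The pieces on `(0, 1]` and `(1, ∞)` contribute `1 / (s + 1)` and `-1 / s`; the strip is where
both integrals converge. -/
lemma hasMellin_truncId {s : ℂ} (h1 : -1 < s.re) (h0 : s.re < 0) :
    HasMellin truncId s (-(1 / (s * (s + 1)))) := by
  have ha := hasMellin_cpow_Ioc 1 (s := s) (by simp; linarith)
  have hre : (s - 1).re < -1 := by simp; linarith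
  have hb : HasMellin (indicator (Ioi 1) (fun _ => 1) : ℝ → ℂ) s (-(1 / s)) := by
    have hsub : Ioi (1 : ℝ) ⊆ Ioi 0 := Ioi_subset_Ioi zero_le_one
    simp_rw [HasMellin, mellin, MellinConvergent, ← indicator_smul, IntegrableOn,
      integrable_indicator_iff measurableSet_Ioi, smul_eq_mul,
      integral_indicator measurableSet_Ioi, mul_one, IntegrableOn,
      Measure.restrict_restrict_of_subset hsub]
    refine ⟨integrableOn_Ioi_cpow_of_lt hre one_pos, ?_⟩
    rw [integral_Ioi_cpow_of_lt hre one_pos]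
    simp [neg_div]
  have := hasMellin_add ha.1 hb.1
  rw [ha.2, hb.2] at this
  have e1 : s ≠ 0 := by rintro rfl; simp at h0
  have e2 : s + 1 ≠ 0 := by
    intro h
    have := congrArg re h
    simp at this; linarith
  refine ⟨this.1, this.2.trans ?_⟩
  field_simp
  ring

lemma integrable_one_div_vert {δ : ℝ} (hδ : 0 < δ) (hδ' : δ ≤ 1 / 2) :
    Integrable fun y : ℝ => -(1 / (vert δ y * (vert δ y + 1))) := by
  have hi := (integrable_rpow_neg_one_add_norm_sq (E := ℝ) (μ := volume) (r := 2)
    (by simp)).const_mul (1 / δ ^ 2)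
  refine hi.mono' (Continuous.aestronglyMeasurable ?_) (Eventually.of_forall fun y => ?_)
  · refine (continuous_const.div (by fun_prop) fun y => ?_).neg
    exact mul_ne_zero (vert_ne_zero hδ y) (vert_add_one_ne_zero (by linarith) y)
  · have h1 := mul_sqrt_le_norm_vert hδ hδ' y
    have h2 := mul_sqrt_le_norm_vert_add_one hδ hδ' y
    have h3 : (0 : ℝ) < √(1 + ‖y‖ ^ 2) := Real.sqrt_pos.2 (by positivity)
    have h4 : (1 + ‖y‖ ^ 2 : ℝ) ^ (-2 / 2 : ℝ) = (√(1 + ‖y‖ ^ 2) * √(1 + ‖y‖ ^ 2))⁻¹ := by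
      rw [Real.mul_self_sqrt (by positivity)]
      norm_num [Real.rpow_neg_one]
    rw [norm_neg, norm_div, norm_mul, norm_one, h4, one_div, one_div, ← mul_inv]
    refine inv_anti₀ (by positivity) ?_
    calc δ ^ 2 * (√(1 + ‖y‖ ^ 2) * √(1 + ‖y‖ ^ 2))
        = (δ * √(1 + ‖y‖ ^ 2)) * (δ * √(1 + ‖y‖ ^ 2)) := by ring
      _ ≤ _ := by gcongr

lemma integral_cpow_mul_one_div_vert {δ : ℝ} (hδ : 0 < δ) (hδ' : δ ≤ 1 / 2) {x : ℝ} (hx : 0 < x) :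
    ∫ y : ℝ, (x : ℂ) ^ (-vert δ y) * -(1 / (vert δ y * (vert δ y + 1))) =
      2 * Real.pi * (min 1 x : ℝ) := by
  have hM : ∀ y : ℝ, mellin truncId (((-δ : ℝ) : ℂ) + y * I) =
      -(1 / (vert δ y * (vert δ y + 1))) := fun y =>
    (hasMellin_truncId (s := vert δ y) (by simp; linarith) (by simp; linarith)).2
  have h := mellinInv_mellin_eq (-δ) truncId hx
    (hasMellin_truncId (by simp; linarith) (by simp; linarith)).1
    ((integrable_one_div_vert hδ hδ').congr (Eventually.of_forall fun y => (hM y).symm))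
    (continuousAt_truncId hx)
  rw [truncId_eq hx, mellinInv] at h
  simp only [hM, smul_eq_mul] at h
  change (1 / (2 * Real.pi)) • ∫ y : ℝ, (x : ℂ) ^ (-vert δ y) *
    -(1 / (vert δ y * (vert δ y + 1))) = _ at h
  rw [← h]
  have : (Real.pi : ℂ) ≠ 0 := by exact_mod_cast Real.pi_ne_zero
  generalize (∫ y : ℝ, (x : ℂ) ^ (-vert δ y) * -(1 / (vert δ y * (vert δ y + 1)))) = J
  rw [Complex.real_smul]
  push_cast
  field_simp

/-! ### The remainder kernel -/

/-- The kernel whose integral against `F (s + w)` on the line `σ = -δ` is the `N`-th remainder. -/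
noncomputable def remainderKernel (N : ℕ) (w : ℂ) : ℂ :=
  -((((N : ℂ) + 1) ^ (w + 1) - (N : ℂ) ^ (w + 1)) / (w * (w + 1)))

lemma natCast_cpow_mul_div {x : ℂ} {m n : ℕ} (hm : m ≠ 0) (w : ℂ) :
    (n : ℂ) ^ (-w) * ((m : ℂ) ^ (w + 1) * x) = m * ((((n : ℝ) / m : ℝ) : ℂ) ^ (-w) * x) := by
  have hm' : (m : ℂ) ≠ 0 := by exact_mod_cast hm
  have h : (((n : ℝ) / m : ℝ) : ℂ) ^ (-w) = (n : ℂ) ^ (-w) * (m : ℂ) ^ w := by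
    rw [div_eq_mul_inv, ofReal_mul, mul_cpow_ofReal_nonneg (by positivity) (by positivity)]
    push_cast
    rw [inv_cpow _ _ (by rw [natCast_arg]; exact Real.pi_pos.ne), cpow_neg (m : ℂ) w, inv_inv]
  rw [h, cpow_add _ _ hm', cpow_one]
  ring

/-- Since `m * min 1 (n / m) = min m n`, the two halves of the kernel yield `min (N + 1) n - min N
n`, a sharp cutoff at integers. -/
lemma integral_cpow_mul_remainderKernel {δ : ℝ} (hδ : 0 < δ) (hδ' : δ ≤ 1 / 2) {N n : ℕ}
    (hN : 1 ≤ N) (hn : 1 ≤ n) :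
    ∫ y : ℝ, (n : ℂ) ^ (-vert δ y) * remainderKernel N (vert δ y) =
      2 * Real.pi * (if n ≤ N then 0 else 1) := by
  have hint : ∀ m : ℕ, 1 ≤ m → Integrable fun y : ℝ =>
      (((n : ℝ) / m : ℝ) : ℂ) ^ (-vert δ y) * -(1 / (vert δ y * (vert δ y + 1))) := by
    intro m hm
    have hq : 0 < (n : ℝ) / m := by positivity
    refine (integrable_one_div_vert hδ hδ').bdd_mul (c := ((n : ℝ) / m) ^ δ) ?_ ?_
    · refine Continuous.aestronglyMeasurable ?_
      exact continuous_const.cpow (by fun_prop) fun y => Or.inl (by simpa using hq)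
    · refine Eventually.of_forall fun y => ?_
      rw [norm_cpow_eq_rpow_re_of_pos hq]; simp
  have hval : ∀ m : ℕ, 1 ≤ m →
      (m : ℂ) * (2 * Real.pi * (min 1 ((n : ℝ) / m) : ℝ)) = 2 * Real.pi * (min m n : ℕ) := by
    intro m hm
    have hm' : (0 : ℝ) < m := by positivity
    have : (m : ℝ) * min 1 ((n : ℝ) / m) = (min m n : ℕ) := by
      rw [mul_min_of_nonneg _ _ hm'.le, mul_one, mul_div_cancel₀ _ hm'.ne']
      push_cast; rfl
    have h2 : (m : ℂ) * (min 1 ((n : ℝ) / m) : ℝ) = (min m n : ℕ) := by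
      rw [← ofReal_natCast, ← ofReal_natCast, ← this, ofReal_mul]
    linear_combination 2 * Real.pi * h2
  have e : ∀ y : ℝ, (n : ℂ) ^ (-vert δ y) * remainderKernel N (vert δ y) =
      ((N + 1 : ℕ) : ℂ) * ((((n : ℝ) / (N + 1 : ℕ) : ℝ) : ℂ) ^ (-vert δ y) *
        -(1 / (vert δ y * (vert δ y + 1)))) -
      (N : ℂ) * ((((n : ℝ) / N : ℝ) : ℂ) ^ (-vert δ y) *
        -(1 / (vert δ y * (vert δ y + 1)))) := by
    intro y
    rw [← natCast_cpow_mul_div (by omega), ← natCast_cpow_mul_div (by omega), remainderKernel]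
    push_cast
    ring
  simp_rw [e]
  rw [integral_sub ((hint _ (by omega)).const_mul _) ((hint _ hN).const_mul _),
    integral_const_mul, integral_const_mul,
    integral_cpow_mul_one_div_vert hδ hδ' (by positivity),
    integral_cpow_mul_one_div_vert hδ hδ' (by positivity), hval _ (by omega), hval _ hN]
  split_ifs with h
  · rw [min_eq_right h, min_eq_right (by omega)]; ring
  · rw [min_eq_left (by omega), min_eq_left (by omega)]; push_cast; ring

lemma continuous_remainderKernel_vert {δ : ℝ} (hδ : 0 < δ) (hδ' : δ ≤ 1 / 2) {N : ℕ}
    (hN : 1 ≤ N) : Continuous fun y => remainderKernel N (vert δ y) := by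
  have h1 : (N : ℂ) ≠ 0 := by exact_mod_cast (by omega : N ≠ 0)
  have h2 : (N : ℂ) + 1 ≠ 0 := by exact_mod_cast (by omega : N + 1 ≠ 0)
  refine (Continuous.div (Continuous.sub ?_ ?_) (by fun_prop) fun y => ?_).neg
  · exact continuous_const.cpow (by fun_prop) fun y => Or.inl (by
      rw [← ofReal_natCast, ← ofReal_one, ← ofReal_add, ofReal_re]; positivity)
  · exact continuous_const.cpow (by fun_prop) fun y => Or.inl (by
      rw [← ofReal_natCast, ofReal_re]; positivity)
  · exact mul_ne_zero (vert_ne_zero hδ y) (vert_add_one_ne_zero (by linarith) y)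

/-- An integrable majorant for the remainder kernels on the line `σ = -δ`. -/
noncomputable def kernelMajorant (δ y : ℝ) : ℝ :=
  4 / δ ^ 2 * (1 + ‖y‖ ^ 2) ^ (-(1 + δ / 2) / 2)

lemma integrable_kernelMajorant {δ : ℝ} (hδ : 0 < δ) : Integrable (kernelMajorant δ) :=
  (integrable_rpow_neg_one_add_norm_sq (by simp; linarith)).const_mul _

/-- The mean value inequality bounds the numerator with good decay in `N` but an extra factor `‖w +
1‖`; the triangle inequality has no such factor but loses a power of `N`. Interpolating with weight
`δ / 2` leaves both decay in `N` and integrability in `y`. -/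
lemma norm_remainderKernel_le {δ : ℝ} (hδ : 0 < δ) (hδ' : δ ≤ 1 / 2) {N : ℕ} (hN : 1 ≤ N)
    (y : ℝ) : ‖remainderKernel N (vert δ y)‖ ≤ (N : ℝ) ^ (-(δ / 2)) * kernelMajorant δ y := by
  set w := vert δ y with hw
  have hN0 : (1 : ℝ) ≤ N := by exact_mod_cast hN
  have hNpos : (0 : ℝ) < N := by linarith
  set A := ‖((N : ℂ) + 1) ^ (w + 1) - (N : ℂ) ^ (w + 1)‖ with hA
  set W := ‖w + 1‖ with hW
  have hWpos : 0 < W := norm_pos_iff.2 (vert_add_one_ne_zero (by linarith) y)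
  have hwpos : 0 < ‖w‖ := norm_pos_iff.2 (vert_ne_zero hδ y)
  have hA1 : A ≤ W * (N : ℝ) ^ (-δ) := by
    have hmv := (convex_Icc (N : ℝ) (N + 1)).norm_image_sub_le_of_norm_hasDerivWithin_le
      (f := fun x : ℝ => (x : ℂ) ^ (w + 1)) (f' := fun x : ℝ => (w + 1) * (x : ℂ) ^ w)
      (C := W * (N : ℝ) ^ (-δ)) (x := N) (y := N + 1) (fun x hx => by
        have hx0 : 0 < x := by linarith [hx.1]
        have := (hasDerivAt_id (x : ℂ)).cpow_const (c := w + 1) (Or.inl (by simpa using hx0))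
        simpa using this.comp_ofReal.hasDerivWithinAt)
      (fun x hx => by
        have hx0 : 0 < x := by linarith [hx.1]
        rw [norm_mul, norm_cpow_eq_rpow_re_of_pos hx0, hw, vert_re]
        gcongr ?_ * ?_
        exact Real.rpow_le_rpow_of_nonpos hNpos hx.1 (by linarith))
      (left_mem_Icc.2 (by linarith)) (right_mem_Icc.2 (by linarith))
    simpa using hmv
  have hA2 : A ≤ (N : ℝ) ^ (-δ) * (4 * N) := by
    have e1 : ‖((N : ℂ) + 1) ^ (w + 1)‖ = ((N : ℝ) + 1) ^ (1 - δ) := by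
      have := norm_cpow_eq_rpow_re_of_pos (show (0 : ℝ) < N + 1 by linarith) (w + 1)
      push_cast at this
      rw [this, hw]; simp; ring_nf
    have e2 : ‖(N : ℂ) ^ (w + 1)‖ = (N : ℝ) ^ (1 - δ) := by
      have := norm_cpow_eq_rpow_re_of_pos hNpos (w + 1)
      push_cast at this
      rw [this, hw]; simp; ring_nf
    have e3 : ((N : ℝ) + 1) ^ (1 - δ) ≤ 2 * (N : ℝ) ^ (1 - δ) := by
      calc ((N : ℝ) + 1) ^ (1 - δ) ≤ (2 * N) ^ (1 - δ) :=
            Real.rpow_le_rpow (by linarith) (by linarith) (by linarith)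
        _ = 2 ^ (1 - δ) * (N : ℝ) ^ (1 - δ) := Real.mul_rpow (by norm_num) hNpos.le
        _ ≤ 2 * (N : ℝ) ^ (1 - δ) := by
            gcongr
            calc (2 : ℝ) ^ (1 - δ) ≤ 2 ^ (1 : ℝ) :=
                  Real.rpow_le_rpow_of_exponent_le (by norm_num) (by linarith)
              _ = 2 := Real.rpow_one 2
    have e4 : (N : ℝ) ^ (1 - δ) = (N : ℝ) ^ (-δ) * N := by
      rw [sub_eq_add_neg, add_comm, Real.rpow_add hNpos, Real.rpow_one]
    have := norm_sub_le (((N : ℂ) + 1) ^ (w + 1)) ((N : ℂ) ^ (w + 1))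
    rw [e1, e2] at this
    have : 0 ≤ (N : ℝ) ^ (1 - δ) := by positivity
    linarith
  -- `X` is the ratio of the trivial bound to the mean value bound; `min 1 X ≤ X ^ (δ / 2)` merges
  -- the two.
  set X := 4 * N / W with hX
  have hXpos : 0 < X := by positivity
  have hA3 : A ≤ W * (N : ℝ) ^ (-δ) * X ^ (δ / 2) := by
    rcases le_total 1 X with h | h
    · have : 1 ≤ X ^ (δ / 2) := Real.one_le_rpow h (by linarith)
      exact hA1.trans (le_mul_of_one_le_right (by positivity) this)
    · have h1 : X ≤ X ^ (δ / 2) := by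
        conv_lhs => rw [← Real.rpow_one X]
        exact Real.rpow_le_rpow_of_exponent_ge hXpos h (by linarith)
      calc A ≤ W * (N : ℝ) ^ (-δ) * X := hA2.trans_eq (by rw [hX]; field_simp)
        _ ≤ _ := by gcongr
  have hXle : X ^ (δ / 2) ≤ 4 * (N : ℝ) ^ (δ / 2) * W ^ (-(δ / 2)) := by
    rw [hX, Real.div_rpow (by positivity) hWpos.le, Real.mul_rpow (by norm_num) hNpos.le,
      Real.rpow_neg hWpos.le, div_eq_mul_inv]
    gcongr
    calc (4 : ℝ) ^ (δ / 2) ≤ 4 ^ (1 : ℝ) :=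
          Real.rpow_le_rpow_of_exponent_le (by norm_num) (by linarith)
      _ = 4 := Real.rpow_one 4
  set S := √(1 + ‖y‖ ^ 2) with hS
  have hSpos : 0 < S := Real.sqrt_pos.2 (by positivity)
  have hS1 : δ * S ≤ ‖w‖ := mul_sqrt_le_norm_vert hδ hδ' y
  have hS2 : δ * S ≤ W := mul_sqrt_le_norm_vert_add_one hδ hδ' y
  have hSrpow : (1 + ‖y‖ ^ 2) ^ (-(1 + δ / 2) / 2) = S⁻¹ * S ^ (-(δ / 2)) := by
    rw [← Real.rpow_neg_one S, ← Real.rpow_add hSpos, hS, Real.sqrt_eq_rpow,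
      ← Real.rpow_mul (by positivity)]
    congr 1; ring
  have hWr : W ^ (-(δ / 2)) ≤ δ⁻¹ * S ^ (-(δ / 2)) := by
    calc W ^ (-(δ / 2)) ≤ (δ * S) ^ (-(δ / 2)) :=
          Real.rpow_le_rpow_of_nonpos (by positivity) hS2 (by linarith)
      _ = δ ^ (-(δ / 2)) * S ^ (-(δ / 2)) := Real.mul_rpow hδ.le hSpos.le
      _ ≤ _ := by
        gcongr
        rw [← Real.rpow_neg_one]
        exact Real.rpow_le_rpow_of_exponent_ge hδ (by linarith) (by linarith)
  have hNN : (N : ℝ) ^ (-δ) * (N : ℝ) ^ (δ / 2) = (N : ℝ) ^ (-(δ / 2)) := by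
    rw [← Real.rpow_add hNpos]; congr 1; ring
  rw [remainderKernel, norm_neg, norm_div, norm_mul, ← hA, ← hW, div_le_iff₀ (by positivity),
    kernelMajorant, hSrpow]
  calc A ≤ W * (N : ℝ) ^ (-δ) * X ^ (δ / 2) := hA3
    _ ≤ W * (N : ℝ) ^ (-δ) * (4 * (N : ℝ) ^ (δ / 2) * (δ⁻¹ * S ^ (-(δ / 2)))) := by
      gcongr
      refine hXle.trans ?_
      gcongr
    _ = W * (4 * (N : ℝ) ^ (-(δ / 2)) * (δ⁻¹ * S ^ (-(δ / 2)))) := by rw [← hNN]; ring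
    _ = (N : ℝ) ^ (-(δ / 2)) * (4 / δ ^ 2 * (S⁻¹ * S ^ (-(δ / 2)))) * ((δ * S) * W) := by
      field_simp
    _ ≤ _ := by gcongr

/-! ### Absolute convergence far to the right -/

lemma partialSum_eq_sum_term (a : ℕ → ℂ) (N : ℕ) (s : ℂ) :
    partialSum a N s = ∑ n ∈ Finset.range (N + 1), LSeries.term a s n := by
  rw [partialSum, Finset.sum_range_succ', LSeries.term_zero, add_zero,
    ← Finset.sum_image (f := LSeries.term a s) (g := fun n => n + 1) (by simp)]
  refine Finset.sum_congr ?_ fun n hn => ?_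
  · ext n
    simp only [Finset.mem_Icc, Finset.mem_image, Finset.mem_range]
    exact ⟨fun h => ⟨n - 1, by omega, by omega⟩, by rintro ⟨m, hm, rfl⟩; omega⟩
  · have hn0 : n ≠ 0 := by
      simp only [Finset.mem_image, Finset.mem_range] at hn; omega
    rw [LSeries.term_of_ne_zero hn0, cpow_neg, div_eq_mul_inv]

/-- Convergence at `s₀` bounds the terms there, so `a n = O(n ^ s₀.re)`. -/
lemma ConvergesAt.lseriesSummable {a : ℕ → ℂ} {s₀ s : ℂ} (h : ConvergesAt a s₀)
    (hs : s₀.re + 1 < s.re) : LSeriesSummable a s := by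
  obtain ⟨l, hl⟩ := h
  have hz : Tendsto (fun N => partialSum a (N + 1) s₀ - partialSum a N s₀) atTop (𝓝 0) := by
    simpa using (hl.comp (tendsto_add_atTop_nat 1)).sub hl
  obtain ⟨C, hC⟩ := (Metric.isBounded_range_of_tendsto _ hz).exists_norm_le
  refine LSeriesSummable_of_le_const_mul_rpow hs ⟨C, fun n hn => ?_⟩
  obtain ⟨m, rfl⟩ := Nat.exists_eq_succ_of_ne_zero hn
  have h1 := hC _ ⟨m, rfl⟩
  simp only [partialSum_eq_sum_term] at h1
  rw [Finset.sum_range_succ, add_sub_cancel_left, LSeries.norm_term_eq, if_neg hn,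
    div_le_iff₀ (by positivity)] at h1
  simpa using h1

lemma LSeriesSummable.tendsto_partialSum {a : ℕ → ℂ} {s : ℂ} (h : LSeriesSummable a s) :
    Tendsto (fun N => partialSum a N s) atTop (𝓝 (LSeries a s)) := by
  simp_rw [partialSum_eq_sum_term]
  exact (h.hasSum.tendsto_sum_nat).comp (tendsto_add_atTop_nat 1)

lemma IsAnalyticContinuation.eq_lseries {a : ℕ → ℂ} {θ : ℝ} {F : ℂ → ℂ}
    (hF : IsAnalyticContinuation a θ F) {s₀ s : ℂ} (h : ConvergesAt a s₀)
    (hs : s₀.re + 1 < s.re) (hsθ : θ < s.re) : F s = LSeries a s := by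
  refine tendsto_nhds_unique (hF.2 s hsθ ?_) (LSeriesSummable.tendsto_partialSum
    (h.lseriesSummable hs))
  refine (sInf_le ⟨s₀, h, rfl⟩ : abscissaOfConv a ≤ _).trans_lt ?_
  exact_mod_cast (by linarith : s₀.re < s.re)

lemma norm_lseries_le_of_re_le {a : ℕ → ℂ} {c : ℝ} (h : LSeriesSummable a c) {s : ℂ}
    (hs : c ≤ s.re) : ‖LSeries a s‖ ≤ ∑' n, ‖LSeries.term a c n‖ :=
  tsum_of_norm_bounded h.norm.hasSum fun n =>
    LSeries.norm_term_le_of_re_le_re a (by simpa using hs) n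

lemma isOpen_halfPlane (κ : ℝ) : IsOpen (halfPlane κ) :=
  isOpen_lt continuous_const continuous_re

lemma convex_halfPlane (κ : ℝ) : Convex ℝ (halfPlane κ) := convex_halfSpace_re_gt κ

lemma halfPlane_subset {κ κ' : ℝ} (h : κ ≤ κ') : halfPlane κ' ⊆ halfPlane κ :=
  fun _ hs => lt_of_le_of_lt h hs

/-! ### Bohr's theorem -/

/-- Inside the region of absolute convergence, the remainder of a Dirichlet series is the integral
of its sum against the remainder kernel. -/
lemma integral_lseries_mul_remainderKernel {a : ℕ → ℂ} {δ : ℝ} (hδ : 0 < δ) (hδ' : δ ≤ 1 / 2)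
    {N : ℕ} (hN : 1 ≤ N) {s : ℂ} (h : LSeriesSummable a (s.re - δ : ℝ)) :
    ∫ y, LSeries a (s + vert δ y) * remainderKernel N (vert δ y) =
      2 * Real.pi * (LSeries a s - partialSum a N s) := by
  set K : ℝ → ℂ := fun y => remainderKernel N (vert δ y)
  have hKc : Continuous K := continuous_remainderKernel_vert hδ hδ' hN
  have hKi : Integrable K := ((integrable_kernelMajorant hδ).const_mul _).mono'
    hKc.aestronglyMeasurable (Eventually.of_forall (norm_remainderKernel_le hδ hδ' hN))
  have hsum : LSeriesSummable a s := h.of_re_le_re (by simp; linarith)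
  have hterm : ∀ n y, LSeries.term a (s + vert δ y) n =
      LSeries.term a s n * (n : ℂ) ^ (-vert δ y) := by
    intro n y
    rcases eq_or_ne n 0 with rfl | hn
    · simp
    · rw [LSeries.term_of_ne_zero hn, LSeries.term_of_ne_zero hn,
        cpow_add _ _ (by exact_mod_cast hn), cpow_neg]
      field_simp
  have hle : ∀ n y, ‖LSeries.term a (s + vert δ y) n * K y‖ ≤
      ‖LSeries.term a (s.re - δ : ℝ) n‖ * ‖K y‖ := by
    intro n y
    rw [norm_mul]
    gcongr
    exact LSeries.norm_term_le_of_re_le_re a (by simp [sub_eq_add_neg]) n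
  have hcont : ∀ n, Continuous fun y => LSeries.term a (s + vert δ y) n * K y := by
    intro n
    rcases eq_or_ne n 0 with rfl | hn
    · simpa using continuous_const
    · simp_rw [hterm]
      refine (continuous_const.mul (continuous_const.cpow (by fun_prop) fun y => Or.inl ?_)).mul hKc
      rw [← ofReal_natCast, ofReal_re]; positivity
  have hint : ∀ n, Integrable fun y => LSeries.term a (s + vert δ y) n * K y := fun n =>
    (hKi.norm.const_mul _).mono' (hcont n).aestronglyMeasurable (Eventually.of_forall (hle n))
  -- On the shifted line all terms have the norms of those at `s.re - δ`, which are summable; this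
  -- justifies integrating term by term.
  have hS : Summable fun n => ∫ y, ‖LSeries.term a (s + vert δ y) n * K y‖ := by
    refine Summable.of_nonneg_of_le (fun n => integral_nonneg fun y => norm_nonneg _) (fun n => ?_)
      (h.norm.mul_right (∫ y, ‖K y‖))
    rw [← integral_const_mul]
    exact integral_mono (hint n).norm (hKi.norm.const_mul _) (hle n)
  have h1 := hasSum_integral_of_summable_integral_norm hint hS
  have h2 : (fun y => ∑' n, LSeries.term a (s + vert δ y) n * K y) =
      fun y => LSeries a (s + vert δ y) * K y := by
    funext y; rw [tsum_mul_right]; rfl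
  rw [h2] at h1
  refine h1.unique ?_
  have h3 : HasSum (fun n => 2 * Real.pi *
      (LSeries.term a s n - if n ∈ Finset.range (N + 1) then LSeries.term a s n else 0))
      (2 * Real.pi * (LSeries a s - partialSum a N s)) := by
    refine (hsum.hasSum.sub ?_).mul_left _
    rw [partialSum_eq_sum_term]
    have h4 := hasSum_sum_of_ne_finset_zero (L := .unconditional ℕ) (s := Finset.range (N + 1))
      (f := fun n => if n ∈ Finset.range (N + 1) then LSeries.term a s n else 0)
      fun n hn => if_neg hn
    rwa [Finset.sum_congr rfl fun n hn => if_pos hn] at h4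
  refine HasSum.congr_fun h3 fun n => ?_
  rcases Nat.eq_zero_or_pos n with rfl | hn
  · simp
  · simp_rw [hterm, mul_assoc]
    rw [integral_const_mul, integral_cpow_mul_remainderKernel hδ hδ' hN hn]
    simp only [Finset.mem_range, Nat.lt_succ_iff]
    split_ifs <;> ring

/-- Integrating the vertical translates of a bounded holomorphic function against an integrable
continuous kernel gives a holomorphic function. -/
lemma differentiableOn_integral_vert {F : ℂ → ℂ} {κ M δ : ℝ}
    (hF : DifferentiableOn ℂ F (halfPlane κ)) (hM : ∀ s ∈ halfPlane κ, ‖F s‖ ≤ M) {k : ℝ → ℂ}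
    (hkc : Continuous k) (hk : Integrable k) :
    DifferentiableOn ℂ (fun s => ∫ y, F (s + vert δ y) * k y) (halfPlane (κ + δ)) := by
  intro s hs
  have hs' : κ + δ < s.re := hs
  -- A third of the available room lets both `x` and a Cauchy circle around `x + vert δ y` move by
  -- `ρ` inside the half-plane, giving `‖deriv F‖ ≤ M / ρ`.
  set ρ := (s.re - κ - δ) / 3 with hρ
  have hρ0 : 0 < ρ := by rw [hρ]; linarith
  have hre : ∀ (z x : ℂ), x ∈ ball z ρ → z.re - ρ < x.re := by
    intro z x hx
    rw [mem_ball, dist_comm, dist_eq_norm] at hx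
    have := (abs_re_le_norm (z - x)).trans_lt hx
    rw [sub_re] at this
    linarith [le_abs_self (z.re - x.re)]
  have hmem : ∀ x ∈ ball s ρ, ∀ y, κ + ρ < (x + vert δ y).re := by
    intro x hx y
    have := hre s x hx
    simp only [add_re, vert_re]
    rw [hρ] at this ⊢; linarith
  have hmem' : ∀ x ∈ ball s ρ, ∀ y, x + vert δ y ∈ halfPlane κ := fun x hx y =>
    show κ < _ by linarith [hmem x hx y]
  have hcont : ∀ G : ℂ → ℂ, ContinuousOn G (halfPlane κ) → ∀ x ∈ ball s ρ,
      AEStronglyMeasurable (fun y => G (x + vert δ y) * k y) volume := by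
    intro G hG x hx
    exact ((hG.comp_continuous (by fun_prop) (hmem' x hx)).mul hkc).aestronglyMeasurable
  have hs0 := mem_ball_self (x := s) hρ0
  have hd := hasDerivAt_integral_of_dominated_loc_of_deriv_le (μ := volume) (𝕜 := ℂ)
    (F := fun x y => F (x + vert δ y) * k y) (F' := fun x y => deriv F (x + vert δ y) * k y)
    (x₀ := s) (s := ball s ρ) (bound := fun y => M / ρ * ‖k y‖) (ball_mem_nhds s hρ0)
    (by filter_upwards [ball_mem_nhds s hρ0] with x hx using hcont F hF.continuousOn x hx)
    ((hk.norm.const_mul M).mono' (hcont F hF.continuousOn s hs0) (Eventually.of_forall fun y => by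
      rw [norm_mul]; gcongr; exact hM _ (hmem' s hs0 y)))
    (hcont _ (hF.deriv (isOpen_halfPlane κ)).continuousOn s hs0)
    (Eventually.of_forall fun y x hx => by
      rw [norm_mul]
      gcongr
      have hsub : closedBall (x + vert δ y) ρ ⊆ halfPlane κ := by
        intro z hz
        rw [mem_closedBall, dist_comm, dist_eq_norm] at hz
        have := (abs_re_le_norm (x + vert δ y - z)).trans hz
        rw [sub_re] at this
        have := le_abs_self ((x + vert δ y).re - z.re)
        have := hmem x hx y
        change κ < z.re
        linarith
      exact norm_deriv_le_of_forall_mem_sphere_norm_le hρ0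
        (hF.mono (closure_ball_subset_closedBall.trans hsub)).diffContOnCl
        fun z hz => hM z (hsub (sphere_subset_closedBall hz)))
    (hk.norm.const_mul _)
    (Eventually.of_forall fun y x hx => by
      have h1 := (hF.differentiableAt ((isOpen_halfPlane κ).mem_nhds (hmem' x hx y))).hasDerivAt
      exact (h1.comp_add_const x (vert δ y)).mul_const (k y))
  exact hd.2.differentiableAt.differentiableWithinAt

/-- **Bohr's theorem**: if a somewhere convergent Dirichlet series has a bounded analytic
continuation to the half-plane `σ > κ`, it converges uniformly in every smaller half-plane. -/
theorem IsAnalyticContinuation.convergesUniformlyOn {a : ℕ → ℂ} {κ M : ℝ} {F : ℂ → ℂ}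
    (ha : SomewhereConvergent a) (hF : IsAnalyticContinuation a κ F)
    (hM : ∀ s ∈ halfPlane κ, ‖F s‖ ≤ M) {ε : ℝ} (hε : 0 < ε) :
    ConvergesUniformlyOn a (halfPlane (κ + ε)) := by
  obtain ⟨s₀, hs₀⟩ := ha
  set δ := min ε (1 / 2)
  have hδ : 0 < δ := by positivity
  have hδ' : δ ≤ 1 / 2 := min_le_right _ _
  have hFd : DifferentiableOn ℂ F (halfPlane κ) := hF.1.differentiableOn
  have hkey : ∀ N, 1 ≤ N → ∀ s ∈ halfPlane (κ + δ),
      ∫ y, F (s + vert δ y) * remainderKernel N (vert δ y) =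
        2 * Real.pi * (F s - partialSum a N s) := by
    intro N hN
    have hKc := continuous_remainderKernel_vert hδ hδ' hN
    have hKi : Integrable fun y => remainderKernel N (vert δ y) :=
      ((integrable_kernelMajorant hδ).const_mul _).mono'
        hKc.aestronglyMeasurable (Eventually.of_forall (norm_remainderKernel_le hδ hδ' hN))
    have hpart : Differentiable ℂ (partialSum a N) := by
      unfold partialSum
      refine Differentiable.fun_sum fun n hn => ?_
      have hn0 : (n : ℂ) ≠ 0 := by
        have := (Finset.mem_Icc.1 hn).1
        exact_mod_cast (by omega : n ≠ 0)
      exact (differentiable_neg.const_cpow (Or.inl hn0)).const_mul _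
    have hL := (differentiableOn_integral_vert (δ := δ) hFd hM hKc hKi).analyticOnNhd
      (isOpen_halfPlane _)
    have hR : AnalyticOnNhd ℂ (fun s => 2 * Real.pi * (F s - partialSum a N s))
        (halfPlane (κ + δ)) :=
      (((hFd.mono (halfPlane_subset (by linarith))).sub hpart.differentiableOn).const_mul
        _).analyticOnNhd (isOpen_halfPlane _)
    -- Beyond `c` even the line shifted left by `δ` lies in the region of absolute convergence, so
    -- the identity is known there and propagates by analyticity.
    set c : ℝ := max (κ + δ) (s₀.re + 1 + δ)
    have hc1 : κ + δ ≤ c := le_max_left _ _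
    have hc2 : s₀.re + 1 + δ ≤ c := le_max_right _ _
    refine hL.eqOn_of_preconnected_of_eventuallyEq hR (convex_halfPlane _).isPreconnected
      (z₀ := ((c + 1 : ℝ) : ℂ)) (show κ + δ < _ by rw [ofReal_re]; linarith) ?_
    filter_upwards [(isOpen_halfPlane c).mem_nhds
      (show c < ((c + 1 : ℝ) : ℂ).re by rw [ofReal_re]; linarith)] with s hs
    have hs' : c < s.re := hs
    have hFs : ∀ y, F (s + vert δ y) = LSeries a (s + vert δ y) := fun y =>
      hF.eq_lseries hs₀ (by simp; linarith) (by simp; linarith)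
    simp_rw [hFs]
    rw [hF.eq_lseries hs₀ (by linarith) (by linarith)]
    exact integral_lseries_mul_remainderKernel hδ hδ' hN
      (hs₀.lseriesSummable (by rw [ofReal_re]; linarith))
  refine ⟨F, ?_⟩
  set B := M * ∫ y, kernelMajorant δ y with hB
  have hlim : Tendsto (fun N : ℕ => (N : ℝ) ^ (-(δ / 2)) * B) atTop (𝓝 0) := by
    simpa using ((tendsto_rpow_neg_atTop (by positivity : 0 < δ / 2)).comp
      tendsto_natCast_atTop_atTop).mul_const B
  rw [Metric.tendstoUniformlyOn_iff]
  intro η hη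
  filter_upwards [hlim.eventually_lt_const hη, eventually_ge_atTop 1] with N hN hN1 s hs
  have hsδ : s ∈ halfPlane (κ + δ) := halfPlane_subset (by linarith [min_le_left ε (1 / 2)]) hs
  have hsv : ∀ y, s + vert δ y ∈ halfPlane κ := fun y => by
    have : κ + δ < s.re := hsδ
    change κ < _
    simp only [add_re, vert_re]; linarith
  have hle : ‖∫ y, F (s + vert δ y) * remainderKernel N (vert δ y)‖ ≤
      (N : ℝ) ^ (-(δ / 2)) * B := by
    have hi := (integrable_kernelMajorant hδ).const_mul (M * (N : ℝ) ^ (-(δ / 2)))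
    refine (norm_integral_le_of_norm_le hi (Eventually.of_forall fun y => ?_)).trans_eq ?_
    · rw [norm_mul, mul_assoc]
      have hM0 : 0 ≤ M := (norm_nonneg _).trans (hM _ (hsv 0))
      gcongr
      · exact hM _ (hsv y)
      · exact norm_remainderKernel_le hδ hδ' hN1 y
    · rw [integral_const_mul, hB]; ring
  rw [hkey N hN1 s hsδ, norm_mul, norm_mul, Complex.norm_ofNat, norm_real, Real.norm_eq_abs,
    abs_of_pos Real.pi_pos] at hle
  rw [dist_eq_norm]
  -- The factor `2π` exceeds `1` and can be dropped.
  nlinarith [Real.pi_gt_three, norm_nonneg (F s - partialSum a N s)]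

/-! ### From two omitted values to uniform convergence -/

/-- A somewhere convergent Dirichlet series whose analytic continuation to `σ > θ` omits two values
is bounded in every smaller half-plane. -/
theorem IsAnalyticContinuation.exists_norm_le_of_mapsTo {a : ℕ → ℂ} {θ : ℝ} {F : ℂ → ℂ}
    {α β : ℂ} (hαβ : α ≠ β) (ha : SomewhereConvergent a) (hF : IsAnalyticContinuation a θ F)
    (hmaps : MapsTo F (halfPlane θ) ({α, β}ᶜ : Set ℂ)) {ε : ℝ} (hε : 0 < ε) :
    ∃ M : ℝ, ∀ s ∈ halfPlane (θ + ε), ‖F s‖ ≤ M := by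
  obtain ⟨s₀, hs₀⟩ := ha
  set c : ℝ := max (s₀.re + 2) (θ + ε + 1)
  have hc1 : s₀.re + 2 ≤ c := le_max_left _ _
  have hc2 : θ + ε + 1 ≤ c := le_max_right _ _
  have hsumm : LSeriesSummable a c := hs₀.lseriesSummable (by rw [ofReal_re]; linarith)
  set M₀ := ∑' n, ‖LSeries.term a c n‖
  have hbd : ∀ s : ℂ, c ≤ s.re → ‖F s‖ ≤ M₀ := fun s hs => by
    rw [hF.eq_lseries hs₀ (by linarith) (by linarith)]
    exact norm_lseries_le_of_re_le hsumm hs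
  have hβα : β - α ≠ 0 := sub_ne_zero.2 hαβ.symm
  obtain ⟨C, hC⟩ := exists_norm_le_of_forall_ne_zero_ne_one (r := c - θ - ε) (R := c - θ)
    (by linarith) (by linarith) ((M₀ + ‖α‖) / ‖β - α‖)
  refine ⟨max M₀ (‖β - α‖ * C + ‖α‖), fun s hs => ?_⟩
  rcases le_or_gt c s.re with h | h
  · exact (hbd s h).trans (le_max_left _ _)
  refine le_trans ?_ (le_max_right _ _)
  set z₀ : ℂ := c + s.im * I with hz₀
  have hz₀re : z₀.re = c := by simp [hz₀]
  have hsub : ball z₀ (c - θ) ⊆ halfPlane θ := by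
    intro z hz
    rw [mem_ball, dist_comm, dist_eq_norm] at hz
    have := (abs_re_le_norm (z₀ - z)).trans_lt hz
    rw [sub_re, hz₀re] at this
    change θ < z.re
    linarith [le_abs_self (c - z.re)]
  have hs' : θ + ε < s.re := hs
  have hmem : s ∈ closedBall z₀ (c - θ - ε) := by
    have e : s - z₀ = ((s.re - c : ℝ) : ℂ) := by
      apply Complex.ext <;> simp [hz₀]
    rw [mem_closedBall, dist_eq_norm, e, norm_real, Real.norm_eq_abs, abs_le]
    constructor <;> linarith
  -- The affine map sending `α, β` to `0, 1` puts `F` in Schottky's normal form.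
  have hCs := hC (fun z => (F z - α) / (β - α)) z₀
    (((hF.1.differentiableOn.mono hsub).sub_const α).div_const _)
    (fun z hz h0 => hmaps (hsub hz) (Or.inl (sub_eq_zero.1 (by simpa [hβα] using h0))))
    (fun z hz h1 => hmaps (hsub hz) (Or.inr (by
      rw [div_eq_one_iff_eq hβα] at h1
      simpa using h1)))
    (by
      rw [norm_div]
      gcongr
      exact (norm_sub_le _ _).trans (by gcongr; exact hbd _ hz₀re.ge)) s hmem
  rw [norm_div, div_le_iff₀ (norm_pos_iff.2 hβα)] at hCs
  have : ‖F s‖ ≤ ‖F s - α‖ + ‖α‖ := by simpa using norm_add_le (F s - α) α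
  linarith

end DirichletSeries

theorem theorem1 (a : ℕ → ℂ) (ha : DirichletSeries.SomewhereConvergent a)
    (θ : ℝ) (α β : ℂ) (hαβ : α ≠ β) (F : ℂ → ℂ)
    (hF : DirichletSeries.IsAnalyticContinuation a θ F)
    (hmaps : Set.MapsTo F (DirichletSeries.halfPlane θ) ({α, β}ᶜ : Set ℂ)) :
    DirichletSeries.abscissaOfUnifConv a ≤ (θ : EReal) ∧
      ∀ ε : ℝ, 0 < ε →
        DirichletSeries.ConvergesUniformlyOn a (DirichletSeries.halfPlane (θ + ε)) := by
  have key : ∀ ε : ℝ, 0 < ε →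
      DirichletSeries.ConvergesUniformlyOn a (DirichletSeries.halfPlane (θ + ε)) := by
    intro ε hε
    -- Half of `ε` is spent on boundedness, the other half on Bohr's theorem.
    obtain ⟨M, hM⟩ := hF.exists_norm_le_of_mapsTo hαβ ha hmaps (half_pos hε)
    have hsub : DirichletSeries.halfPlane (θ + ε / 2) ⊆ DirichletSeries.halfPlane θ :=
      DirichletSeries.halfPlane_subset (by linarith)
    have hF' : DirichletSeries.IsAnalyticContinuation a (θ + ε / 2) F :=
      ⟨hF.1.mono hsub, fun s hs => hF.2 s (hsub hs)⟩
    have := hF'.convergesUniformlyOn ha hM (half_pos hε)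
    rwa [add_assoc, add_halves] at this
  refine ⟨EReal.le_of_forall_lt_iff_le.1 fun x hx => ?_, key⟩
  have hx' : θ < x := by exact_mod_cast hx
  refine sInf_le ⟨x, ?_, rfl⟩
  have := key (x - θ) (sub_pos.2 hx')
  rwa [add_sub_cancel] at this
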